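/- Let $d\in\mathbb N$, and let $M_n$ be the complex $n\times n$ matrices. A set $\mathcal S=\bigcup_n\mathcal S_n$ with $\mathcal S_n\subseteq (M_n)^d_{sa}$ ($d$-tuples of self-adjoint matrices) is called matrix convex if it is closed under direct sums, under simultaneous unitary conjugation, and under application of unital completely positive maps $M_n\to M_k$ to all entries of a tuple; no closedness is assumed. Inclusions are levelwise, $c\,\mathcal S=\{(cX_1,\dots,cX_d):X\in\mathcal S\}$, and $(M_1)^d_{sa}$ is identified with $\mathbb R^d$. Let $\overline{\mathbb B}$ be the closed Euclidean unit ball of $\mathbb R^d$, let $$\mathfrak B=\Big\{X\in\bigcup_n(M_n)^d_{sa}:\ \sum_{j=1}^d X_j^2\le I\Big\},\qquad \mathfrak D=\Big\{X\in\bigcup_n(M_n)^d_{sa}:\ \Big\|\sum_{j=1}^d X_j\otimes\overline{X_j}\Big\|\le 1\Big\},$$ where $\overline{X_j}$ is the entrywise complex conjugate and $\|\cdot\|$ the operator norm, and let $$\mathfrak B^\bullet=\Big\{X\in\bigcup_n(M_n)^d_{sa}:\ \sum_{j=1}^d A_j\otimes X_j\le I\ \text{ for all } A\in\mathfrak B\Big\}$$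 be the polar dual of $\mathfrak B$. **Theorem.** For every matrix convex set $\mathcal S\subseteq\bigcup_n(M_n)^d_{sa}$, $$\mathcal S_1\subseteq\overline{\mathbb B}\ \Longrightarrow\ \mathcal S\subseteq\sqrt d\,\mathfrak B\subseteq\sqrt d\,\mathfrak D,$$ $$\overline{\mathbb B}\subseteq\mathcal S_1\ \Longrightarrow\ \mathfrak D\subseteq\mathfrak B^\bullet\subseteq\sqrt d\,\mathcal S.$$ Moreover, the constant $\sqrt d$ is optimal in both implications: if $C\ge 0$ is a constant such that $\mathcal S\subseteq C\,\mathfrak D$ for every matrix convex $\mathcal S\subseteq\bigcup_n(M_n)^d_{sa}$ with $\mathcal S_1\subseteq\overline{\mathbb B}$, then $C\ge\sqrt d$, and likewise with $\mathfrak B$ in place of $\mathfrak D$; and if $C\ge0$ is a constant such that $\mathfrak D\subseteq C\,\mathcal S$ for every matrix convex $\mathcal S\subseteq\bigcup_n(M_n)^d_{sa}$ with $\overline{\mathbb B}\subseteq\mathcal S_1$, then $C\ge\sqrt d$, and likewise with $\mathfrak B^\bullet$ in place of $\mathfrak D$. -/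

import Mathlib

open scoped Matrix Kronecker ComplexOrder

namespace MatrixBall

/-- A `d`-tuple of complex `n × n` matrices. -/
abbrev Tuple (d n : ℕ) : Type := Fin d → Matrix (Fin n) (Fin n) ℂ

/-- A free set in `d` free dimensions: one set of `d`-tuples of `n × n` matrices for every `n`.
Its order `S ≤ T` is levelwise inclusion, `S n ⊆ T n` for all `n`.  (At level `0` there is only one
tuple; it satisfies all the matrix inequalities below, so that level carries no information.) -/
abbrev FreeSet (d : ℕ) : Type := (n : ℕ) → Set (Tuple d n)

/-- The map `id ⊗ φ` from `M_p(M_n)` to `M_p(M_k)`, where `M_p(M_n)` is the algebra of matrices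
indexed by `Fin p × Fin n`: it applies `φ` to each of the `p²` blocks of size `n × n`. -/
def ampliation {n k : ℕ} (φ : Matrix (Fin n) (Fin n) ℂ →ₗ[ℂ] Matrix (Fin k) (Fin k) ℂ) (p : ℕ)
    (P : Matrix (Fin p × Fin n) (Fin p × Fin n) ℂ) :
    Matrix (Fin p × Fin k) (Fin p × Fin k) ℂ :=
  Matrix.of fun a b => φ (Matrix.of fun i j => P (a.1, i) (b.1, j)) a.2 b.2

/-- Unital completely positive maps from `M_n` to `M_k`. -/
structure IsUCP {n k : ℕ} (φ : Matrix (Fin n) (Fin n) ℂ →ₗ[ℂ] Matrix (Fin k) (Fin k) ℂ) :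
    Prop where
  map_one : φ 1 = 1
  completely_positive : ∀ (p : ℕ) (P : Matrix (Fin p × Fin n) (Fin p × Fin n) ℂ),
    P.PosSemidef → (ampliation φ p P).PosSemidef

/-- The direct sum `X ⊕ Y` of two tuples. -/
def directSum {d m n : ℕ} (X : Tuple d m) (Y : Tuple d n) : Tuple d (m + n) := fun j =>
  Matrix.reindex finSumFinEquiv finSumFinEquiv (Matrix.fromBlocks (X j) 0 0 (Y j))

/-- An nc set: a free set closed under direct sums and simultaneous unitary conjugation. -/
structure IsNCSet {d : ℕ} (S : FreeSet d) : Prop where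
  directSum_mem : ∀ (m n : ℕ) (X : Tuple d m) (Y : Tuple d n),
    X ∈ S m → Y ∈ S n → directSum X Y ∈ S (m + n)
  unitary_conj_mem : ∀ (n : ℕ) (X : Tuple d n), X ∈ S n →
    ∀ U ∈ Matrix.unitaryGroup (Fin n) ℂ, (fun j => Uᴴ * X j * U) ∈ S n

/-- A matrix convex set: an nc set closed under unital completely positive maps. -/
structure IsMatrixConvex {d : ℕ} (S : FreeSet d) : Prop extends IsNCSet S where
  ucp_mem : ∀ (n k : ℕ) (X : Tuple d n), X ∈ S n →
    ∀ φ : Matrix (Fin n) (Fin n) ℂ →ₗ[ℂ] Matrix (Fin k) (Fin k) ℂ,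
      IsUCP φ → (fun j => φ (X j)) ∈ S k

/-- The free set consists of tuples of self-adjoint matrices. -/
def IsSelfAdjointSet {d : ℕ} (S : FreeSet d) : Prop :=
  ∀ (n : ℕ) (X : Tuple d n), X ∈ S n → ∀ j, (X j).IsHermitian

/-- The first level of a set of self-adjoint tuples, as a subset of `ℝ^d`: a vector `x` is
identified with the tuple of `1 × 1` matrices `(x_1), …, (x_d)`. -/
def firstLevel {d : ℕ} (S : FreeSet d) : Set (EuclideanSpace ℝ (Fin d)) :=
  {x | (fun j => Matrix.of fun _ _ => ((x j : ℝ) : ℂ) : Tuple d 1) ∈ S 1}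

/-- The scaled free set `c S = {c X : X ∈ S}`. -/
def scale {d : ℕ} (c : ℝ) (S : FreeSet d) : FreeSet d := fun n =>
  {X | ∃ Y ∈ S n, X = fun j => (c : ℂ) • Y j}

/-- The polar dual of a set of self-adjoint tuples, within the self-adjoint tuples:
`X` belongs to it when `∑ A_j ⊗ X_j ≤ I` for all `A ∈ S`, of every size. -/
def polarDual {d : ℕ} (S : FreeSet d) : FreeSet d := fun n =>
  {X | (∀ j, (X j).IsHermitian) ∧
    ∀ (m : ℕ) (A : Tuple d m), A ∈ S m → (1 - ∑ j, A j ⊗ₖ X j).PosSemidef}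

/-- The matrix ball: self-adjoint tuples with `∑ X_j² ≤ I`. -/
def matrixBall (d : ℕ) : FreeSet d := fun _ =>
  {X | (∀ j, (X j).IsHermitian) ∧ (1 - ∑ j, X j ^ 2).PosSemidef}

open scoped Matrix.Norms.L2Operator in
/-- The self-dual matrix ball: self-adjoint tuples with `‖∑ X_j ⊗ conj X_j‖ ≤ 1`, where `conj` is
the entrywise complex conjugate and the norm is the operator norm on `ℂ^n ⊗ ℂ^n`. -/
def selfDualBall (d : ℕ) : FreeSet d := fun _ =>
  {X | (∀ j, (X j).IsHermitian) ∧ ‖∑ j, X j ⊗ₖ (X j).map star‖ ≤ 1}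

end MatrixBall

/-! Upper bound: compressing to a unit vector is a ucp map into `M_1`, so joint numerical ranges of
`S` lie in `S_1`. Hence each `X_j` satisfies `-1 ≤ X_j ≤ 1`, so `X_j² ≤ 1`, and summing gives `∑
X_j² ≤ d`.

The inclusion `𝔅 ⊆ 𝔇` comes from expanding `∑ (A_j ⊗ 1 + 1 ⊗ X_j)² ≥ 0`. Then `𝔇 ⊆ 𝔅•` is a
Cauchy–Schwarz inequality (`posSemidef_one_sub_sum_kronecker`): identify vectors with matrices `V`,
so that `A ⊗ X` becomes `V ↦ X V Aᵀ`, and dominate the cross term at `V` by the diagonal terms at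
`|V*|` and `|V|`.

Lower bound: it suffices to write `X_j / √d = P_{j,+} - P_{j,-}` with positive `P_{j,±}` of total
sum `1`, since `X / √d` is then a ucp image of a diagonal tuple built from the points `± e_j` of
`S_1`. If this fails, Hahn–Banach gives Hermitian `a, b_j` with `a ± b_j > 0` and `tr a + ∑ tr (b_j
X_j) / √d < 0`. But the contractions `a^{-1/2} b_j a^{-1/2}`, divided by `√d`, form a point of `𝔅`.
Testing `X ∈ 𝔅•` against the negative of its transpose, at the vector `a^{1/2}`, contradicts the
inequality.

Optimality: Clifford generators satisfy `(∑ x_j F_j)² = |x|²`, so `F` lies in the polar `maxBall` of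
the scalar ball, while `F / √d` lies in `𝔅`. Tracial test vectors then force `C ≥ √d` for `maxBall`
and for its polar dual. -/

namespace MatrixBall

/-! ### Kronecker products and their quadratic forms. -/

section Kronecker

open Matrix

variable {m n ι : Type*} [Fintype ι]

theorem posSemidef_half {A : Matrix n n ℂ} (h : ((2 : ℂ) • A).PosSemidef) : A.PosSemidef := by
  have := h.smul (a := (2⁻¹ : ℂ)) (by simp)
  simpa [smul_smul] using this

theorem map_star_eq_transpose {X : Matrix n n ℂ} (hX : X.IsHermitian) : X.map star = Xᵀ := by
  ext i j; simpa using hX.apply j i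

theorem isHermitian_map_star {X : Matrix n n ℂ} (hX : X.IsHermitian) :
    (X.map star).IsHermitian := by
  rw [map_star_eq_transpose hX]; exact hX.transpose

theorem isHermitian_kronecker {A : Matrix m m ℂ} {X : Matrix n n ℂ} (hA : A.IsHermitian)
    (hX : X.IsHermitian) : (A ⊗ₖ X).IsHermitian := by
  rw [IsHermitian, conjTranspose_kronecker, hA.eq, hX.eq]

theorem isHermitian_sum {A : ι → Matrix m m ℂ} (hA : ∀ j, (A j).IsHermitian) :
    (∑ j, A j).IsHermitian := by
  rw [IsHermitian, conjTranspose_sum]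
  exact Finset.sum_congr rfl fun j _ => (hA j).eq

theorem isHermitian_sum_kronecker {A : ι → Matrix m m ℂ} {X : ι → Matrix n n ℂ}
    (hA : ∀ j, (A j).IsHermitian) (hX : ∀ j, (X j).IsHermitian) :
    (∑ j, A j ⊗ₖ X j).IsHermitian :=
  isHermitian_sum fun j => isHermitian_kronecker (hA j) (hX j)

theorem sum_kronecker (A : ι → Matrix m m ℂ) (X : Matrix n n ℂ) :
    (∑ j, A j) ⊗ₖ X = ∑ j, A j ⊗ₖ X := by
  ext; simp [kroneckerMap_apply, Matrix.sum_apply, Finset.sum_mul]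

theorem kronecker_sum (A : Matrix m m ℂ) (X : ι → Matrix n n ℂ) :
    A ⊗ₖ (∑ j, X j) = ∑ j, A ⊗ₖ X j := by
  ext; simp [kroneckerMap_apply, Matrix.sum_apply, Finset.mul_sum]

theorem sub_kronecker (A B : Matrix m m ℂ) (X : Matrix n n ℂ) :
    (A - B) ⊗ₖ X = A ⊗ₖ X - B ⊗ₖ X := by
  ext; simp [kroneckerMap_apply, sub_mul]

theorem kronecker_sub (A : Matrix m m ℂ) (X Y : Matrix n n ℂ) :
    A ⊗ₖ (X - Y) = A ⊗ₖ X - A ⊗ₖ Y := by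
  ext; simp [kroneckerMap_apply, mul_sub]

theorem trace_fromBlocks_eq [Fintype m] [Fintype n] (A : Matrix m m ℂ) (B : Matrix m n ℂ)
    (C : Matrix n m ℂ) (D : Matrix n n ℂ) : (fromBlocks A B C D).trace = A.trace + D.trace := by
  simp [trace]

/-- Every vector of the tensor product is some `V.vec`, so positivity of Kronecker expressions
becomes a family of trace inequalities. -/
theorem star_vec_kronecker_mulVec_vec [Fintype m] [Fintype n] (A : Matrix m m ℂ)
    (X : Matrix n n ℂ) (V : Matrix n m ℂ) :
    star V.vec ⬝ᵥ ((A ⊗ₖ X) *ᵥ V.vec) = (Vᴴ * X * V * Aᵀ).trace := by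
  rw [kronecker_mulVec_vec, star_vec_dotProduct_vec]
  simp only [Matrix.mul_assoc]

theorem posSemidef_kronecker [Fintype m] [Fintype n] {A : Matrix m m ℂ}
    {X : Matrix n n ℂ} (hA : A.PosSemidef) (hX : X.PosSemidef) : (A ⊗ₖ X).PosSemidef :=
  hA.kronecker hX

end Kronecker

/-! ### Operator inequalities and the Cauchy–Schwarz inequality. -/

section PosSemidef

open Matrix

variable {m n ι : Type*} [Fintype m] [DecidableEq m] [Fintype n] [DecidableEq n]

/-- If `-1 ≤ B ≤ 1` then `B² ≤ 1`. -/
theorem posSemidef_one_sub_sq {B : Matrix n n ℂ} (h₁ : (1 - B).PosSemidef)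
    (h₂ : (1 + B).PosSemidef) : (1 - B ^ 2).PosSemidef := by
  apply posSemidef_half
  -- `2(1 - B²) = (1 + B)(1 - B)(1 + B) + (1 - B)(1 + B)(1 - B)`.
  have h := (h₁.conjTranspose_mul_mul_same (1 + B)).add (h₂.conjTranspose_mul_mul_same (1 - B))
  rw [h₁.isHermitian.eq, h₂.isHermitian.eq] at h
  convert h using 1
  simp only [two_smul]
  noncomm_ring

/-- If `B² ≤ 1` and `B` is Hermitian, then `B ≤ 1`. -/
theorem posSemidef_one_sub_of_sq {B : Matrix n n ℂ} (hB : B.IsHermitian)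
    (h : (1 - B ^ 2).PosSemidef) : (1 - B).PosSemidef := by
  apply posSemidef_half
  -- `2(1 - B) = (1 - B)² + (1 - B²)`.
  have h' := (posSemidef_conjTranspose_mul_self (1 - B)).add h
  rw [(isHermitian_one.sub hB).eq] at h'
  convert h' using 1
  simp only [two_smul]
  noncomm_ring

open scoped Matrix.Norms.L2Operator MatrixOrder in
theorem l2_opNorm_le_one_iff {T : Matrix n n ℂ} (hT : T.IsHermitian) :
    ‖T‖ ≤ 1 ↔ (1 - T).PosSemidef ∧ (1 + T).PosSemidef := by
  have hT' : IsSelfAdjoint T := hT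
  constructor
  · intro h
    have h1 : algebraMap ℝ (Matrix n n ℂ) ‖T‖ ≤ 1 := by
      simpa using algebraMap_mono (Matrix n n ℂ) h
    have h2 := hT'.le_algebraMap_norm_self.trans h1
    have h3 := (neg_le_neg h1).trans hT'.neg_algebraMap_norm_le_self
    refine ⟨Matrix.le_iff.1 h2, ?_⟩
    have := Matrix.le_iff.1 h3
    rwa [sub_neg_eq_add, add_comm] at this
  · rintro ⟨h1, h2⟩
    have h3 : T ^ 2 ≤ 1 := Matrix.le_iff.2 (posSemidef_one_sub_sq h1 h2)
    have h4 : star T * T = T ^ 2 := by rw [hT'.star_eq, sq]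
    have h5 : ‖star T * T‖ ≤ 1 :=
      (CStarAlgebra.norm_le_one_iff_of_nonneg _ (star_mul_self_nonneg T)).2 (h4 ▸ h3)
    rw [CStarRing.norm_star_mul_self] at h5
    nlinarith [norm_nonneg T]

open scoped MatrixOrder Matrix.Norms.L2Operator in
theorem trace_mul_nonneg {P Q : Matrix n n ℂ} (hP : P.PosSemidef) (hQ : Q.PosSemidef) :
    0 ≤ (P * Q).trace := by
  obtain ⟨B, rfl⟩ := CStarAlgebra.nonneg_iff_eq_star_mul_self.1 hQ.nonneg
  rw [← mul_assoc, trace_mul_comm, star_eq_conjTranspose, ← mul_assoc]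
  exact (hP.mul_mul_conjTranspose_same B).trace_nonneg

theorem star_vec_one_sub_sum_mulVec_vec [Fintype ι] (A : ι → Matrix m m ℂ) (X : ι → Matrix n n ℂ)
    (V : Matrix n m ℂ) :
    star V.vec ⬝ᵥ ((1 - ∑ j, A j ⊗ₖ X j) *ᵥ V.vec) =
      (Vᴴ * V).trace - ∑ j, (Vᴴ * X j * V * (A j)ᵀ).trace := by
  simp_rw [sub_mulVec, sum_mulVec, dotProduct_sub, dotProduct_sum, one_mulVec,
    star_vec_kronecker_mulVec_vec, star_vec_dotProduct_vec]

/-- Twice the matrix is `(1 - ∑ A_j²) ⊗ 1 + 1 ⊗ (1 - ∑ X_j²) + ∑ (A_j ⊗ 1 + 1 ⊗ X_j)²`. -/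
theorem posSemidef_one_add_sum_kronecker [Fintype ι] {A : ι → Matrix m m ℂ}
    {X : ι → Matrix n n ℂ} (hA : ∀ j, (A j).IsHermitian) (hX : ∀ j, (X j).IsHermitian)
    (hA' : (1 - ∑ j, A j ^ 2).PosSemidef) (hX' : (1 - ∑ j, X j ^ 2).PosSemidef) :
    (1 + ∑ j, A j ⊗ₖ X j).PosSemidef := by
  apply posSemidef_half
  have h1 := posSemidef_kronecker hA' (PosSemidef.one (n := n) (R := ℂ))
  have h2 := posSemidef_kronecker (PosSemidef.one (n := m) (R := ℂ)) hX'
  have h3 : (∑ j, (A j ⊗ₖ (1 : Matrix n n ℂ) + (1 : Matrix m m ℂ) ⊗ₖ X j) ^ 2).PosSemidef :=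
    posSemidef_sum _ fun j _ => by
      have : (A j ⊗ₖ (1 : Matrix n n ℂ) + (1 : Matrix m m ℂ) ⊗ₖ X j).IsHermitian :=
        (isHermitian_kronecker (hA j) isHermitian_one).add
          (isHermitian_kronecker isHermitian_one (hX j))
      have h := posSemidef_conjTranspose_mul_self
        (A j ⊗ₖ (1 : Matrix n n ℂ) + (1 : Matrix m m ℂ) ⊗ₖ X j)
      rwa [this.eq, ← sq] at h
  have h4 : ∀ j, (A j ⊗ₖ (1 : Matrix n n ℂ) + (1 : Matrix m m ℂ) ⊗ₖ X j) ^ 2 =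
      (A j ^ 2) ⊗ₖ (1 : Matrix n n ℂ) + (1 : Matrix m m ℂ) ⊗ₖ (X j ^ 2) +
        (2 : ℂ) • (A j ⊗ₖ X j) := fun j => by
    rw [sq, mul_add, add_mul, add_mul]
    simp only [← mul_kronecker_mul, one_mul, mul_one, sq, two_smul]
    abel
  rw [sub_kronecker, sum_kronecker, one_kronecker_one] at h1
  rw [kronecker_sub, kronecker_sum, one_kronecker_one] at h2
  rw [Finset.sum_congr rfl fun j _ => h4 j] at h3
  convert (h1.add h2).add h3 using 1
  simp only [two_smul, Finset.sum_add_distrib]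
  abel

/-- The quadratic form at `q.vec`, where conjugates of Hermitian matrices are transposes. The primed
version removes the transposes by using `qᵀ`. -/
theorem trace_sum_le_of_posSemidef [Fintype ι] {A : ι → Matrix m m ℂ}
    (hA : ∀ j, (A j).IsHermitian) (h : (1 - ∑ j, A j ⊗ₖ (A j).map star).PosSemidef)
    {q : Matrix m m ℂ} (hq : q.IsHermitian) :
    ∑ j, (q * (A j)ᵀ * q * (A j)ᵀ).trace ≤ (q * q).trace := by
  have := h.dotProduct_mulVec_nonneg q.vec
  rw [star_vec_one_sub_sum_mulVec_vec, sub_nonneg, hq.eq] at this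
  simpa only [map_star_eq_transpose (hA _)] using this

theorem trace_sum_le_of_posSemidef' [Fintype ι] {A : ι → Matrix m m ℂ}
    (hA : ∀ j, (A j).IsHermitian) (h : (1 - ∑ j, A j ⊗ₖ (A j).map star).PosSemidef)
    {q : Matrix m m ℂ} (hq : q.IsHermitian) :
    ∑ j, (q * A j * q * A j).trace ≤ (q * q).trace := by
  have := trace_sum_le_of_posSemidef hA h hq.transpose
  have e : ∀ j, (q * A j * q * A j).trace = (qᵀ * (A j)ᵀ * qᵀ * (A j)ᵀ).trace := fun j => by
    rw [← trace_transpose (q * A j * q * A j)]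
    simp only [transpose_mul]
    rw [trace_mul_comm]
    simp only [Matrix.mul_assoc]
  simp_rw [e]
  rwa [← transpose_mul, trace_transpose] at this

open scoped Matrix.Norms.L2Operator MatrixOrder in
/-- For every matrix `V`, the block matrices `[[|V*|, ±V], [±V*, |V|]]` are positive. -/
theorem exists_posSemidef_fromBlocks (V : Matrix n m ℂ) :
    ∃ (p : Matrix n n ℂ) (q : Matrix m m ℂ), p.IsHermitian ∧ q.IsHermitian ∧
      p * p = V * Vᴴ ∧ q * q = Vᴴ * V ∧
      (fromBlocks p V Vᴴ q).PosSemidef ∧ (fromBlocks p (-V) (-Vᴴ) q).PosSemidef := by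
  set p := CFC.sqrt (V * Vᴴ) with hp
  set q := CFC.sqrt (Vᴴ * V) with hq
  have hp0 : p.PosSemidef := Matrix.nonneg_iff_posSemidef.1 (CFC.sqrt_nonneg _)
  have hq0 : q.PosSemidef := Matrix.nonneg_iff_posSemidef.1 (CFC.sqrt_nonneg _)
  have hpp : p * p = V * Vᴴ :=
    CFC.sqrt_mul_sqrt_self _ (posSemidef_self_mul_conjTranspose V).nonneg
  have hqq : q * q = Vᴴ * V :=
    CFC.sqrt_mul_sqrt_self _ (posSemidef_conjTranspose_mul_self V).nonneg
  -- `H` is self-adjoint with `|H| = p ⊕ q`, and `|H| ± H` are twice its positive and negative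
  -- parts.
  set H : Matrix (n ⊕ m) (n ⊕ m) ℂ := fromBlocks 0 V Vᴴ 0 with hH
  have hHH : IsSelfAdjoint H := by
    rw [isSelfAdjoint_iff, star_eq_conjTranspose, hH, fromBlocks_conjTranspose]; simp
  have hR : CFC.abs H = fromBlocks p 0 0 q := by
    refine CFC.sqrt_unique ?_ ?_
    · rw [hHH.star_eq, hH, fromBlocks_multiply, fromBlocks_multiply]; simp [hpp, hqq]
    · set p' := CFC.sqrt p with hp'
      set q' := CFC.sqrt q with hq'
      have hp'' : p'ᴴ * p' = p := by
        rw [(Matrix.nonneg_iff_posSemidef.1 (CFC.sqrt_nonneg p)).isHermitian.eq]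
        exact CFC.sqrt_mul_sqrt_self _ hp0.nonneg
      have hq'' : q'ᴴ * q' = q := by
        rw [(Matrix.nonneg_iff_posSemidef.1 (CFC.sqrt_nonneg q)).isHermitian.eq]
        exact CFC.sqrt_mul_sqrt_self _ hq0.nonneg
      have := posSemidef_conjTranspose_mul_self (fromBlocks p' 0 0 q')
      rw [fromBlocks_conjTranspose, fromBlocks_multiply] at this
      simp only [hp'', hq'', conjTranspose_zero, add_zero, zero_add,
        Matrix.mul_zero, Matrix.zero_mul] at this
      exact this.nonneg
  refine ⟨p, q, hp0.isHermitian, hq0.isHermitian, hpp, hqq, ?_, ?_⟩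
  · have h := CFC.abs_add_self H hHH
    have h0 : 0 ≤ CFC.abs H + H := by rw [h]; exact nsmul_nonneg (CFC.posPart_nonneg H) 2
    rw [hR, hH, fromBlocks_add] at h0
    simpa using Matrix.nonneg_iff_posSemidef.1 h0
  · have h := CFC.abs_sub_self H hHH
    have h0 : 0 ≤ CFC.abs H - H := by rw [h]; exact nsmul_nonneg (CFC.negPart_nonneg H) 2
    rw [hR, hH, sub_eq_add_neg, fromBlocks_neg, fromBlocks_add] at h0
    simpa using Matrix.nonneg_iff_posSemidef.1 h0

/-- The Cauchy–Schwarz inequality for the self-dual norm, for Hermitian tuples. -/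
theorem posSemidef_one_sub_sum_kronecker [Fintype ι] {A : ι → Matrix m m ℂ}
    {X : ι → Matrix n n ℂ} (hA : ∀ j, (A j).IsHermitian) (hX : ∀ j, (X j).IsHermitian)
    (hA' : (1 - ∑ j, A j ⊗ₖ (A j).map star).PosSemidef)
    (hX' : (1 - ∑ j, X j ⊗ₖ (X j).map star).PosSemidef) :
    (1 - ∑ j, A j ⊗ₖ X j).PosSemidef := by
  refine .of_dotProduct_mulVec_nonneg
    (isHermitian_one.sub (isHermitian_sum_kronecker hA hX)) fun v => ?_
  obtain ⟨V, rfl⟩ := vec_bijective.2 v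
  rw [star_vec_one_sub_sum_mulVec_vec]
  obtain ⟨p, q, hp, hq, hpp, hqq, h1, h2⟩ := exists_posSemidef_fromBlocks V
  -- With `M = X_j ⊕ A_jᵀ`, this is `tr (M H₊ M H₋) ≥ 0` for the positive block matrices `H_±` with
  -- off-diagonal blocks `±V, ±V*`.
  have key : ∀ j, 0 ≤ (p * X j * p * X j).trace + (q * (A j)ᵀ * q * (A j)ᵀ).trace -
      2 * (Vᴴ * X j * V * (A j)ᵀ).trace := fun j => by
    set M := fromBlocks (X j) 0 0 (A j)ᵀ with hM
    have hMh : Mᴴ = M := by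
      rw [hM, fromBlocks_conjTranspose, (hX j).eq, (hA j).transpose.eq]; simp
    have h := trace_mul_nonneg (h1.conjTranspose_mul_mul_same M) h2
    rw [hMh, hM] at h
    simp only [fromBlocks_multiply, trace_fromBlocks_eq, Matrix.mul_zero, Matrix.zero_mul, add_zero,
      zero_add, Matrix.mul_neg, trace_add, trace_neg] at h
    have e1 : (X j * p * X j * p).trace = (p * X j * p * X j).trace := by
      rw [trace_mul_comm]; simp only [Matrix.mul_assoc]
    have e2 : ((A j)ᵀ * q * (A j)ᵀ * q).trace = (q * (A j)ᵀ * q * (A j)ᵀ).trace := by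
      rw [trace_mul_comm]; simp only [Matrix.mul_assoc]
    have e3 : (X j * V * (A j)ᵀ * Vᴴ).trace = (Vᴴ * X j * V * (A j)ᵀ).trace := by
      rw [trace_mul_comm]; simp only [Matrix.mul_assoc]
    have e4 : ((A j)ᵀ * Vᴴ * X j * V).trace = (Vᴴ * X j * V * (A j)ᵀ).trace := by
      rw [Matrix.mul_assoc, Matrix.mul_assoc, trace_mul_comm]; simp only [Matrix.mul_assoc]
    rw [e1, e2, e3, e4] at h
    convert h using 1
    ring
  have hs := Finset.sum_nonneg fun j (_ : j ∈ Finset.univ) => key j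
  rw [Finset.sum_sub_distrib, Finset.sum_add_distrib, ← Finset.mul_sum] at hs
  have h3 := trace_sum_le_of_posSemidef hA hA' hq
  have h4 := trace_sum_le_of_posSemidef' hX hX' hp
  rw [hqq] at h3
  rw [hpp, trace_mul_comm] at h4
  have h5 : 0 ≤ 2 * ((Vᴴ * V).trace - ∑ j, (Vᴴ * X j * V * (A j)ᵀ).trace) := by
    refine hs.trans ?_
    rw [mul_sub, two_mul (Vᴴ * V).trace]
    gcongr
  have h6 := mul_nonneg (a := (2⁻¹ : ℂ)) (by simp) h5
  rwa [inv_mul_cancel_left₀ two_ne_zero] at h6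

end PosSemidef

/-! ### Compact slices of the positive semidefinite cone. -/

section PosSemidefCone

open Matrix

variable {n : Type*} [Fintype n]

theorem trace_mul_vecMulVec_star (a : Matrix n n ℂ) (v : n → ℂ) :
    (a * vecMulVec v (star v)).trace = star v ⬝ᵥ (a *ᵥ v) := by
  rw [mul_vecMulVec, trace_vecMulVec, dotProduct_comm]

theorem posDef_add_of_trace_mul_pos {a b : Matrix n n ℂ} (ha : a.IsHermitian)
    (hb : b.IsHermitian)
    (h : ∀ v : n → ℂ, v ≠ 0 → 0 < ((a + b) * vecMulVec v (star v)).trace) : (a + b).PosDef :=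
  .of_dotProduct_mulVec_pos (ha.add hb) fun v hv => by
    rw [← trace_mul_vecMulVec_star]; exact h v hv

/-- The `2 × 2` minor on `i, j` gives `|P_ij|² ≤ P_ii P_jj`. This bounds slices of fixed trace. -/
theorem norm_apply_le_trace {P : Matrix n n ℂ} (hP : P.PosSemidef) (i j : n) :
    ‖P i j‖ ≤ P.trace.re := by
  have hdiag : ∀ i, 0 ≤ (P i i).re ∧ (P i i).im = 0 := fun i => by
    have := Complex.le_def.1 (hP.diag_nonneg (i := i)); simpa [eq_comm] using this
  have hle : ∀ i, (P i i).re ≤ P.trace.re := fun i => by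
    rw [trace, Complex.re_sum]
    exact Finset.single_le_sum (f := fun i => (P i i).re) (fun i _ => (hdiag i).1)
      (Finset.mem_univ i)
  have h := (hP.submatrix ![i, j]).det_nonneg
  rw [det_fin_two] at h
  simp only [submatrix_apply, cons_val_zero, cons_val_one] at h
  rw [← hP.isHermitian.apply j i] at h
  have h2 := (Complex.le_def.1 h).1
  rw [Complex.star_def, Complex.mul_conj] at h2
  simp only [Complex.zero_re, Complex.sub_re, Complex.mul_re, (hdiag i).2, (hdiag j).2,
    Complex.ofReal_re, Complex.normSq_eq_norm_sq] at h2
  have h3 := mul_le_mul (hle i) (hle j) (hdiag j).1 ((hdiag i).1.trans (hle i))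
  exact abs_le_of_sq_le_sq' (by nlinarith) ((hdiag i).1.trans (hle i)) |>.2

theorem isClosed_posSemidef : IsClosed {P : Matrix n n ℂ | P.PosSemidef} := by
  simp only [posSemidef_iff_dotProduct_mulVec, Set.ofPred_and, Set.ofPred_forall]
  refine IsClosed.inter ?_ (isClosed_iInter fun x => ?_)
  · exact isClosed_eq (Continuous.matrix_conjTranspose continuous_id) continuous_id
  · exact isClosed_le continuous_const (by fun_prop)

theorem isCompact_posSemidef_trace_eq {I : Type*} [Fintype I] (c : ℂ) :
    IsCompact {P : I → Matrix n n ℂ | (∀ i, (P i).PosSemidef) ∧ ∑ i, (P i).trace = c} := by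
  have hc : IsCompact {P : I → Matrix n n ℂ | ∀ i a b, P i a b ∈ Metric.closedBall (0 : ℂ) c.re} := by
    have := isCompact_univ_pi fun _ : I => isCompact_univ_pi fun _ : n => isCompact_univ_pi
      fun _ : n => isCompact_closedBall (0 : ℂ) c.re
    refine Eq.mp (congrArg _ ?_) this
    refine Set.ext fun P => ?_
    simp only [Set.mem_pi, Set.mem_univ, true_imp_iff]
    exact Iff.rfl
  have htr : Continuous fun P : I → Matrix n n ℂ => ∑ i, (P i).trace :=
    continuous_finsetSum _ fun i _ => (continuous_apply i).matrix_trace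
  refine hc.of_isClosed_subset ?_ ?_
  · rw [Set.ofPred_and, Set.ofPred_forall]
    exact (isClosed_iInter fun i => isClosed_posSemidef.preimage (continuous_apply i)).inter
      (isClosed_eq htr continuous_const)
  · rintro P ⟨hP, rfl⟩ i a b
    rw [mem_closedBall_zero_iff, Complex.re_sum]
    refine (norm_apply_le_trace (hP i) a b).trans ?_
    exact Finset.single_le_sum (f := fun i => (P i).trace.re)
      (fun i _ => (Complex.le_def.1 (hP i).trace_nonneg).1) (Finset.mem_univ i)

end PosSemidefCone

/-! ### Matrix decomposition by Hahn–Banach separation. -/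

section Separation

open Matrix

variable {n J : Type*} [Fintype n] [DecidableEq n] [Fintype J]

/-- A real-linear functional on the Hermitian matrices is the pairing with a Hermitian matrix. -/
theorem exists_isHermitian_trace_eq (l : Matrix n n ℂ →ₗ[ℝ] ℝ) :
    ∃ a : Matrix n n ℂ, a.IsHermitian ∧ ∀ M : Matrix n n ℂ, M.IsHermitian →
      (a * M).trace = (l M : ℂ) := by
  -- Chosen so that `Re tr (b M) = l M` for every `M`; on Hermitian `M` the Hermitian part of `b`
  -- then represents `l`.
  set b : Matrix n n ℂ := of fun i j =>
    (l (single j i 1) : ℂ) - Complex.I * l (single j i Complex.I) with hb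
  have hre : ∀ M : Matrix n n ℂ, ((b * M).trace).re = l M := fun M => by
    conv_rhs => rw [matrix_eq_sum_single M]
    have hs : ∀ (i j : n) (z : ℂ), single i j z =
        z.re • single i j (1 : ℂ) + z.im • single i j Complex.I := fun i j z => by
      rw [smul_single, smul_single, ← single_add]
      congr 1
      simp [Complex.re_add_im]
    simp only [map_sum, trace, diag, mul_apply, Complex.re_sum]
    rw [Finset.sum_comm]
    refine Finset.sum_congr rfl fun i _ => Finset.sum_congr rfl fun j _ => ?_
    rw [hs i j, map_add, map_smul, map_smul]
    simp [hb]
    ring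
  refine ⟨(2⁻¹ : ℂ) • (b + bᴴ), ?_, fun M hM => ?_⟩
  · rw [IsHermitian, conjTranspose_smul, conjTranspose_add, conjTranspose_conjTranspose, add_comm]
    simp
  · have h1 : (bᴴ * M).trace = star ((b * M).trace) := by
      rw [← trace_conjTranspose, conjTranspose_mul, hM.eq, trace_mul_comm]
    rw [smul_mul_assoc, trace_smul, add_mul, trace_add, h1, ← hre M]
    have := Complex.add_conj ((b * M).trace)
    rw [Complex.star_def, this]
    simp

open scoped Matrix.Norms.L2Operator MatrixOrder in
/-- If `-a ≤ b j ≤ a` for all `j` then the pairing of `(a, b)` with `(1, X / √d)` is nonnegative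
for every `X` in the polar dual of the matrix ball. -/
theorem trace_add_sum_nonneg {X : J → Matrix n n ℂ}
    (h : ∀ C : J → Matrix n n ℂ, (∀ j, (C j).IsHermitian) → (1 - ∑ j, C j ^ 2).PosSemidef →
      (1 - ∑ j, C j ⊗ₖ X j).PosSemidef)
    [Nonempty J] {a : Matrix n n ℂ} {b : J → Matrix n n ℂ} (hb : ∀ j, (b j).IsHermitian)
    (ha : a.PosDef) (h₁ : ∀ j, (a + b j).PosSemidef) (h₂ : ∀ j, (a - b j).PosSemidef) :
    0 ≤ a.trace + ∑ j, ((√(Fintype.card J : ℝ))⁻¹ : ℂ) * (b j * X j).trace := by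
  set S := CFC.sqrt a with hS
  have hSS : S * S = a := CFC.sqrt_mul_sqrt_self _ ha.posSemidef.nonneg
  have hSh : S.IsHermitian := (Matrix.nonneg_iff_posSemidef.1 (CFC.sqrt_nonneg a)).isHermitian
  have hSu : IsUnit S.det := by
    have := (isUnit_iff_isUnit_det _).1 ha.isUnit
    rw [← hSS, det_mul] at this
    exact isUnit_of_mul_isUnit_left this
  have hTh : (S⁻¹).IsHermitian := hSh.inv
  have hTa : S⁻¹ * a * S⁻¹ = 1 := by
    rw [← hSS, ← mul_assoc, nonsing_inv_mul _ hSu, one_mul, mul_nonsing_inv _ hSu]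
  -- Conjugation by `a^{-1/2}` turns `-a ≤ b j ≤ a` into a contraction bound.
  have hB : ∀ j, (1 - (S⁻¹ * b j * S⁻¹) ^ 2).PosSemidef := fun j => by
    apply posSemidef_one_sub_sq
    · have := (h₂ j).conjTranspose_mul_mul_same S⁻¹
      rwa [hTh.eq, mul_sub, sub_mul, hTa] at this
    · have := (h₁ j).conjTranspose_mul_mul_same S⁻¹
      rwa [hTh.eq, mul_add, add_mul, hTa] at this
  have hBh : ∀ j, (S⁻¹ * b j * S⁻¹).IsHermitian := fun j => by
    rw [IsHermitian, conjTranspose_mul, conjTranspose_mul, hTh.eq, (hb j).eq, mul_assoc]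
  set r : ℂ := ((√(Fintype.card J : ℝ))⁻¹ : ℂ) with hr
  have hrr : r * r = ((Fintype.card J : ℂ))⁻¹ := by
    rw [hr, ← mul_inv]
    congr 1
    rw [← Complex.ofReal_mul, Real.mul_self_sqrt (Nat.cast_nonneg _), Complex.ofReal_natCast]
  have hrs : star r = r := by simp [hr]
  have hcard : (Fintype.card J : ℂ) ≠ 0 := by simp
  -- The squares of `d` contractions sum to at most `d`, hence the factor `r = 1/√d`. The transpose
  -- cancels the one in the trace formula, and the sign yields a lower bound.
  have key := h (fun j => -(r • (S⁻¹ * b j * S⁻¹)ᵀ)) (fun j => by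
    rw [IsHermitian, conjTranspose_neg, conjTranspose_smul, (hBh j).transpose.eq, hrs]) (by
    have hsum : (∑ j : J, (r * r) • (1 - (S⁻¹ * b j * S⁻¹) ^ 2)ᵀ).PosSemidef :=
      posSemidef_sum _ fun j _ => (hB j).transpose.smul (by
        rw [hrr]; exact inv_nonneg.2 (Nat.cast_nonneg _))
    convert hsum using 1
    simp only [neg_sq, smul_pow, transpose_sub, transpose_one, transpose_pow, smul_sub,
      Finset.sum_sub_distrib, sq r, Finset.sum_const, Finset.card_univ]
    congr 1
    rw [hrr, ← Nat.cast_smul_eq_nsmul ℂ, smul_smul, mul_inv_cancel₀ hcard, one_smul])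
  have h3 := key.dotProduct_mulVec_nonneg S.vec
  rw [star_vec_one_sub_sum_mulVec_vec, hSh.eq, hSS] at h3
  have h4 : ∀ j, (S * X j * S * (-(r • (S⁻¹ * b j * S⁻¹)ᵀ))ᵀ).trace =
      -(r * (b j * X j).trace) := fun j => by
    rw [transpose_neg, transpose_smul, transpose_transpose, mul_neg, trace_neg, mul_smul_comm,
      trace_smul, smul_eq_mul]
    have : S * X j * S * (S⁻¹ * b j * S⁻¹) = S * X j * b j * S⁻¹ := by
      rw [mul_assoc (S * X j), ← mul_assoc S, ← mul_assoc S, mul_nonsing_inv _ hSu, one_mul]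
      simp only [mul_assoc]
    rw [this, trace_mul_comm, ← mul_assoc, ← mul_assoc, nonsing_inv_mul _ hSu, one_mul,
      trace_mul_comm]
  simpa only [h4, Finset.sum_neg_distrib, sub_neg_eq_add] using h3

/-- Up to the factor `√d`, a tuple in the polar dual of the matrix ball is a combination of the
vectors `± e_j` with matrix coefficients. -/
theorem exists_posSemidef_decomposition [DecidableEq J] [Nonempty J]
    {X : J → Matrix n n ℂ} (hX : ∀ j, (X j).IsHermitian)
    (h : ∀ C : J → Matrix n n ℂ, (∀ j, (C j).IsHermitian) → (1 - ∑ j, C j ^ 2).PosSemidef →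
      (1 - ∑ j, C j ⊗ₖ X j).PosSemidef) :
    ∃ P : J × Bool → Matrix n n ℂ, (∀ i, (P i).PosSemidef) ∧ ∑ i, P i = 1 ∧
      ∀ j, P (j, true) - P (j, false) = ((√(Fintype.card J : ℝ))⁻¹ : ℂ) • X j := by
  rcases isEmpty_or_nonempty n with hn | hn
  · exact ⟨0, fun _ => .zero, Subsingleton.elim _ _, fun j => Subsingleton.elim _ _⟩
  set r : ℂ := ((√(Fintype.card J : ℝ))⁻¹ : ℂ) with hr
  set c : ℝ := ((Fintype.card n : ℕ) : ℝ) with hc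
  have hc0 : 0 < c := by simp [hc, Fintype.card_pos]
  -- Only the total trace is fixed, at `c = tr 1`. This makes `K` compact, and the constraint `∑ P i
  -- = 1` goes into the target of `L`.
  set K := {P : J × Bool → Matrix n n ℂ | (∀ i, (P i).PosSemidef) ∧ ∑ i, (P i).trace = (c : ℂ)}
    with hK
  let L : (J × Bool → Matrix n n ℂ) →ₗ[ℝ] Matrix n n ℂ × (J → Matrix n n ℂ) :=
    { toFun := fun P => (∑ i, P i, fun j => P (j, true) - P (j, false))
      map_add' := fun P Q => by
        ext1
        · simp [Finset.sum_add_distrib]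
        · funext j; simp [add_sub_add_comm]
      map_smul' := fun t P => by
        ext1
        · simp [Finset.smul_sum]
        · funext j; simp [smul_sub] }
  have hLc : Continuous L := by
    change Continuous fun P : J × Bool → Matrix n n ℂ =>
      (∑ i, P i, fun j => P (j, true) - P (j, false))
    fun_prop
  have hLK : IsCompact (L '' K) := (isCompact_posSemidef_trace_eq _).image hLc
  have hconv : Convex ℝ (L '' K) := by
    have hKc : Convex ℝ K := fun P hP Q hQ s t hs ht hst => ⟨fun i => ?_, ?_⟩
    · exact hKc.linear_image L
    · exact ((hP.1 i).smul hs).add ((hQ.1 i).smul ht)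
    · simp only [Pi.add_apply, Pi.smul_apply, trace_add, trace_smul, Finset.sum_add_distrib,
        ← Finset.smul_sum, hP.2, hQ.2]
      rw [← add_smul, hst, one_smul]
  by_cases hmem : ((1 : Matrix n n ℂ), fun j => r • X j) ∈ L '' K
  · obtain ⟨P, hP, hPL⟩ := hmem
    exact ⟨P, hP.1, congrArg Prod.fst hPL, fun j => congrFun (congrArg Prod.snd hPL) j⟩
  exfalso
  have : LocallyConvexSpace ℝ (Matrix n n ℂ) :=
    inferInstanceAs (LocallyConvexSpace ℝ (n → n → ℂ))
  obtain ⟨f, u, hfx, hfK⟩ := geometric_hahn_banach_point_closed hconv hLK.isClosed hmem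
  -- normalise the functional so that it is positive on the cone spanned by `L '' K`
  let τ : Matrix n n ℂ →ₗ[ℝ] ℝ := Complex.reLm ∘ₗ (traceLinearMap n ℝ ℂ)
  obtain ⟨a, ha, hal⟩ := exists_isHermitian_trace_eq
    (f.toLinearMap ∘ₗ LinearMap.inl ℝ _ _ - (u / c) • τ)
  choose b hb hbl using fun j => exists_isHermitian_trace_eq
    (f.toLinearMap ∘ₗ LinearMap.inr ℝ (Matrix n n ℂ) _ ∘ₗ
      LinearMap.single ℝ (fun _ : J => Matrix n n ℂ) j)
  have hpos : ∀ j (ε : Bool) (v : n → ℂ), v ≠ 0 →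
      0 < ((a + (if ε then b j else -b j)) * vecMulVec v (star v)).trace := by
    intro j ε v hv
    set p := vecMulVec v (star v) with hp
    have hp0 : p.PosSemidef := posSemidef_vecMulVec_self_star v
    have htr : p.trace = (τ p : ℂ) := by
      have := (Complex.le_def.1 hp0.trace_nonneg).2
      exact Complex.ext rfl (by simpa using this.symm)
    have ht : 0 < τ p := by
      have h1 : 0 < p.trace := by
        rw [hp, trace_vecMulVec, dotProduct_comm]; exact dotProduct_star_self_pos_iff.2 hv
      exact (Complex.lt_def.1 h1).1
    -- A rank-one matrix in a single slot, rescaled into the slice, isolates `a + b j` or `a - b j`.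
    have hmemK : Pi.single (j, ε) ((c / τ p) • p) ∈ K := by
      refine ⟨fun i => ?_, ?_⟩
      · rcases eq_or_ne i (j, ε) with rfl | hi
        · rw [Pi.single_eq_same]; exact hp0.smul (div_nonneg hc0.le ht.le)
        · rw [Pi.single_eq_of_ne hi]; exact .zero
      · rw [Finset.sum_eq_single (j, ε)]
        · rw [Pi.single_eq_same, trace_smul, htr, Complex.real_smul, ← Complex.ofReal_mul,
            div_mul_cancel₀ _ ht.ne']
        · intro i _ hi; rw [Pi.single_eq_of_ne hi, trace_zero]
        · simp
    have hL : L (Pi.single (j, ε) ((c / τ p) • p)) =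
        (c / τ p) • (p, Pi.single j (if ε then p else -p)) := by
      ext1
      · change ∑ i, (Pi.single (j, ε) ((c / τ p) • p) : J × Bool → Matrix n n ℂ) i = _
        simp
      · funext k
        change (Pi.single (j, ε) ((c / τ p) • p) : J × Bool → Matrix n n ℂ) (k, true) -
          (Pi.single (j, ε) ((c / τ p) • p) : J × Bool → Matrix n n ℂ) (k, false) = _
        rcases eq_or_ne k j with rfl | hk
        · cases ε <;> simp
        · simp [hk]
    have h1 := hfK _ ⟨_, hmemK, rfl⟩
    rw [hL, map_smul, smul_eq_mul] at h1
    have h2 : f (p, Pi.single j (if ε then p else -p)) =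
        f (p, 0) + (if ε then f (0, Pi.single j p) else -f (0, Pi.single j p)) := by
      have : ((p, Pi.single j (if ε then p else -p)) : Matrix n n ℂ × (J → Matrix n n ℂ)) =
          (p, 0) + (if ε then (0, Pi.single j p) else -(0, Pi.single j p)) := by
        cases ε <;> ext1 <;> simp [Pi.single_neg]
      rw [this, map_add]
      cases ε <;> simp only [Bool.false_eq_true, if_false, if_true, map_neg]
    have h3 : ((a + (if ε then b j else -b j)) * p).trace =
        ((f (p, Pi.single j (if ε then p else -p)) - u / c * τ p : ℝ) : ℂ) := by
      rw [h2, add_mul, trace_add, hal p hp0.isHermitian]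
      have h4 := hbl j p hp0.isHermitian
      cases ε
      · simp only [Bool.false_eq_true, if_false, neg_mul, trace_neg, h4]
        simp; ring
      · simp only [if_true, h4]
        simp; ring
    rw [h3]
    have h5 : u / c * τ p < f (p, Pi.single j (if ε then p else -p)) := by
      rw [div_mul_eq_mul_div, lt_div_iff₀ ht] at h1
      rw [div_mul_eq_mul_div, div_lt_iff₀ hc0]; linarith
    exact_mod_cast sub_pos.2 h5
  have hplus : ∀ j, (a + b j).PosDef := fun j =>
    posDef_add_of_trace_mul_pos ha (hb j) fun v hv => by simpa using hpos j true v hv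
  have hminus : ∀ j, (a - b j).PosDef := fun j => by
    rw [sub_eq_add_neg]
    exact posDef_add_of_trace_mul_pos ha (hb j).neg fun v hv => by simpa using hpos j false v hv
  have haP : a.PosDef := by
    obtain ⟨j⟩ := ‹Nonempty J›
    have := ((hplus j).add (hminus j)).smul (a := (2⁻¹ : ℂ)) (by simp)
    have e : a + b j + (a - b j) = (2 : ℂ) • a := by rw [two_smul]; abel
    rwa [e, smul_smul, inv_mul_cancel₀ two_ne_zero, one_smul] at this
  have hfin := trace_add_sum_nonneg h hb haP (fun j => (hplus j).posSemidef)
    (fun j => (hminus j).posSemidef)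
  rw [← hr] at hfin
  have hrX : ∀ j, (r • X j).IsHermitian := fun j => by
    rw [IsHermitian, conjTranspose_smul, (hX j).eq]; simp [hr]
  have e1 : a.trace + ∑ j, r * (b j * X j).trace =
      ((f (1, fun j => r • X j) - u : ℝ) : ℂ) := by
    have e2 : ∀ j, r * (b j * X j).trace = (f (0, Pi.single j (r • X j)) : ℂ) := fun j => by
      rw [← smul_eq_mul, ← trace_smul, ← mul_smul_comm, hbl j _ (hrX j)]; rfl
    have e3 : a.trace = ((f (1, 0) - u : ℝ) : ℂ) := by
      rw [← mul_one a, hal 1 isHermitian_one]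
      have : τ 1 = c := by simp [τ, hc]
      simp [this, hc0.ne']
    have e4 : ((1, fun j => r • X j) : Matrix n n ℂ × (J → Matrix n n ℂ)) =
        (1, 0) + ∑ j, (0, Pi.single j (r • X j)) := by
      ext1
      · simp [Prod.fst_sum]
      · rw [Prod.snd_add, Prod.snd_sum, zero_add]
        exact (Finset.univ_sum_single (fun j => r • X j)).symm
    rw [e4, map_add, map_sum, e3, Finset.sum_congr rfl fun j _ => e2 j]
    push_cast; ring
  rw [e1] at hfin
  have : 0 ≤ f (1, fun j => r • X j) - u := by exact_mod_cast hfin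
  linarith

end Separation

/-! ### Unital completely positive maps. -/

section UCP

open Matrix

variable {d m n k : ℕ}

/-- The compression `T ↦ Vᴴ T V` as a linear map. -/
def compression (V : Matrix (Fin n) (Fin k) ℂ) :
    Matrix (Fin n) (Fin n) ℂ →ₗ[ℂ] Matrix (Fin k) (Fin k) ℂ where
  toFun T := Vᴴ * T * V
  map_add' S T := by rw [Matrix.mul_add, Matrix.add_mul]
  map_smul' c T := by simp

theorem isUCP_compression {V : Matrix (Fin n) (Fin k) ℂ} (hV : Vᴴ * V = 1) :
    IsUCP (compression V) where
  map_one := by simp [compression, hV]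
  completely_positive p P hP := by
    have h := hP.conjTranspose_mul_mul_same ((1 : Matrix (Fin p) (Fin p) ℂ) ⊗ₖ V)
    convert h using 1
    ext ⟨a, i⟩ ⟨b, j⟩
    simp [ampliation, compression, Matrix.mul_apply, Fintype.sum_prod_type, Matrix.one_apply,
      ite_mul, apply_ite]

/-- The map `T ↦ ∑ T_ii P_i` from `M_m` to `M_n`. -/
def diagonalMap (P : Fin m → Matrix (Fin n) (Fin n) ℂ) :
    Matrix (Fin m) (Fin m) ℂ →ₗ[ℂ] Matrix (Fin n) (Fin n) ℂ where
  toFun T := ∑ i, T i i • P i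
  map_add' S T := by simp [add_smul, Finset.sum_add_distrib]
  map_smul' c T := by simp [Finset.smul_sum, smul_smul]

/-- The ampliation sends `Q` to `∑ Q_ii ⊗ P_i`, where the `Q_ii` are principal `p × p` submatrices
of `Q`. -/
theorem isUCP_diagonalMap {P : Fin m → Matrix (Fin n) (Fin n) ℂ} (hP : ∀ i, (P i).PosSemidef)
    (h1 : ∑ i, P i = 1) : IsUCP (diagonalMap P) where
  map_one := by simpa [diagonalMap] using h1
  completely_positive p Q hQ := by
    have h : (∑ i, Q.submatrix (fun a => (a, i)) (fun a => (a, i)) ⊗ₖ P i).PosSemidef :=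
      posSemidef_sum _ fun i _ => posSemidef_kronecker (hQ.submatrix _) (hP i)
    convert h using 1
    ext a b
    simp [ampliation, diagonalMap, Matrix.sum_apply]

theorem IsUCP.map_posSemidef {φ : Matrix (Fin n) (Fin n) ℂ →ₗ[ℂ] Matrix (Fin k) (Fin k) ℂ}
    (hφ : IsUCP φ) {M : Matrix (Fin n) (Fin n) ℂ} (hM : M.PosSemidef) : (φ M).PosSemidef :=
  (hφ.completely_positive 1 _ (hM.submatrix Prod.snd)).submatrix fun i => (0, i)

/-- A Hermitian `M` is a difference of positives: `4M = (1 + M)² - (1 - M)²`. -/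
theorem IsUCP.map_isHermitian {φ : Matrix (Fin n) (Fin n) ℂ →ₗ[ℂ] Matrix (Fin k) (Fin k) ℂ}
    (hφ : IsUCP φ) {M : Matrix (Fin n) (Fin n) ℂ} (hM : M.IsHermitian) : (φ M).IsHermitian := by
  have h1 := hφ.map_posSemidef (posSemidef_conjTranspose_mul_self (1 + M))
  have h2 := hφ.map_posSemidef (posSemidef_conjTranspose_mul_self (1 - M))
  rw [(isHermitian_one.add hM).eq] at h1
  rw [(isHermitian_one.sub hM).eq] at h2
  have e : M = (4⁻¹ : ℂ) • ((1 + M) * (1 + M) - (1 - M) * (1 - M)) := by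
    have : (1 + M) * (1 + M) - (1 - M) * (1 - M) = (4 : ℂ) • M := by
      have h4 : (4 : ℂ) • M = M + M + M + M := by
        rw [show (4 : ℂ) = 1 + 1 + 1 + 1 by norm_num]; simp only [add_smul, one_smul]
      rw [h4]; noncomm_ring
    rw [this, smul_smul, inv_mul_cancel₀ (by norm_num), one_smul]
  rw [e, map_smul, map_sub, IsHermitian, conjTranspose_smul,
    (h1.isHermitian.sub h2.isHermitian).eq]
  simp

end UCP

/-! ### Matrix convex sets and the two chains of inclusions. -/

section MatrixConvex

open Matrix

variable {d n : ℕ} {S : FreeSet d}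

/-- Iterated direct sums of first-level points. The size `m + 1` starts the induction at one point,
since `S 0` may be empty. -/
theorem IsMatrixConvex.diagonal_mem (hS : IsMatrixConvex S) : ∀ (m : ℕ)
    (x : Fin (m + 1) → EuclideanSpace ℝ (Fin d)), (∀ i, x i ∈ firstLevel S) →
      (fun j => diagonal fun i => ((x i j : ℝ) : ℂ) : Tuple d (m + 1)) ∈ S (m + 1)
  | 0, x, hx => by
    have h : (fun j => of fun _ _ => ((x 0 j : ℝ) : ℂ) : Tuple d 1) ∈ S 1 := hx 0
    convert h using 1
    funext j
    ext a b
    obtain rfl := Fin.fin_one_eq_zero a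
    obtain rfl := Fin.fin_one_eq_zero b
    exact diagonal_apply_eq _ _
  | m + 1, x, hx => by
    have h := hS.directSum_mem _ _ _ _ (hS.diagonal_mem m (fun i => x i.castSucc)
      fun i => hx _) (hx (Fin.last _))
    convert h using 1
    funext j
    ext a b
    obtain ⟨a, rfl⟩ := finSumFinEquiv.surjective a
    obtain ⟨b, rfl⟩ := finSumFinEquiv.surjective b
    simp only [directSum, reindex_apply, submatrix_apply, Equiv.symm_apply_apply]
    rcases a with a | a <;> rcases b with b | b
    · simp only [fromBlocks_apply₁₁, diagonal_apply, finSumFinEquiv_apply_left,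
        Fin.castAdd_inj]
      rfl
    · have : finSumFinEquiv (m := m + 1) (Sum.inl a) ≠ finSumFinEquiv (Sum.inr b) :=
        finSumFinEquiv.injective.ne (by simp)
      rw [fromBlocks_apply₁₂, diagonal_apply_ne _ this, Matrix.zero_apply]
    · have : finSumFinEquiv (m := m + 1) (Sum.inr a) ≠ finSumFinEquiv (Sum.inl b) :=
        finSumFinEquiv.injective.ne (by simp)
      rw [fromBlocks_apply₂₁, diagonal_apply_ne _ this, Matrix.zero_apply]
    · rw [Subsingleton.elim a 0, Subsingleton.elim b 0]
      simp only [fromBlocks_apply₂₂, diagonal_apply_eq, of_apply, finSumFinEquiv_apply_right]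
      rfl

/-- A matrix convex set contains all combinations of points of its first level with positive
matrix coefficients that sum to the identity. -/
theorem IsMatrixConvex.sum_smul_mem (hS : IsMatrixConvex S) {ι : Type*} [Fintype ι] [Nonempty ι]
    {x : ι → EuclideanSpace ℝ (Fin d)} (hx : ∀ i, x i ∈ firstLevel S)
    {P : ι → Matrix (Fin n) (Fin n) ℂ} (hP : ∀ i, (P i).PosSemidef) (h1 : ∑ i, P i = 1) :
    (fun j => ∑ i, ((x i j : ℝ) : ℂ) • P i : Tuple d n) ∈ S n := by
  obtain ⟨m, hm⟩ := Nat.exists_eq_succ_of_ne_zero (Fintype.card_ne_zero (α := ι))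
  let e : Fin (m + 1) ≃ ι := (Fintype.equivFinOfCardEq hm).symm
  have h := hS.ucp_mem _ _ _ (hS.diagonal_mem m (x ∘ e) fun i => hx _) _
    (isUCP_diagonalMap (P := P ∘ e) (fun i => hP _) (by rw [← h1]; exact e.sum_comp P))
  convert h using 1
  funext j
  simp only [diagonalMap, LinearMap.coe_mk, AddHom.coe_mk, diagonal_apply_eq, Function.comp]
  exact (e.sum_comp fun i => ((x i j : ℝ) : ℂ) • P i).symm

theorem posSemidef_of_re_le {X : Matrix (Fin n) (Fin n) ℂ} (hX : X.IsHermitian)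
    (h : ∀ v : Fin n → ℂ, star v ⬝ᵥ v = 1 → 0 ≤ (star v ⬝ᵥ (X *ᵥ v)).re) : X.PosSemidef := by
  refine .of_dotProduct_mulVec_nonneg hX fun v => ?_
  have him : (star v ⬝ᵥ (X *ᵥ v)).im = 0 := hX.im_star_dotProduct_mulVec_self v
  rw [Complex.le_def]
  refine ⟨?_, him.symm⟩
  rcases eq_or_ne v 0 with rfl | hv
  · simp
  have hpos : 0 < star v ⬝ᵥ v := dotProduct_star_self_pos_iff.2 hv
  obtain ⟨hr, hi⟩ := Complex.lt_def.1 hpos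
  set t := (star v ⬝ᵥ v).re with ht
  have htv : star v ⬝ᵥ v = t := Complex.ext rfl (by simpa using hi.symm)
  have ht0 : 0 < t := hr
  set s : ℝ := (√t)⁻¹ with hs
  have hss : s * s = t⁻¹ := by rw [hs, ← mul_inv, Real.mul_self_sqrt ht0.le]
  have hstar : star ((s : ℂ) • v) = (s : ℂ) • star v := by
    rw [star_smul]; simp
  have key := h ((s : ℂ) • v) (by
    rw [hstar, smul_dotProduct, dotProduct_smul, smul_smul, htv, smul_eq_mul,
      ← Complex.ofReal_mul, hss, ← Complex.ofReal_mul, inv_mul_cancel₀ ht0.ne', Complex.ofReal_one])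
  rw [hstar, mulVec_smul, smul_dotProduct, dotProduct_smul, smul_smul, smul_eq_mul,
    ← Complex.ofReal_mul, hss, Complex.re_ofReal_mul] at key
  exact nonneg_of_mul_nonneg_right key (inv_pos.2 ht0)

/-- A unit vector is an isometry from `ℂ`, so compression by it is ucp into `M_1`. -/
theorem IsMatrixConvex.numericalRange_mem (hS : IsMatrixConvex S) (hs : IsSelfAdjointSet S)
    {X : Tuple d n} (hX : X ∈ S n) {v : Fin n → ℂ} (hv : star v ⬝ᵥ v = 1) :
    WithLp.toLp 2 (fun j => (star v ⬝ᵥ (X j *ᵥ v)).re) ∈ firstLevel S := by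
  set V : Matrix (Fin n) (Fin 1) ℂ := of fun i _ => v i with hV
  have hVV : Vᴴ * V = 1 := by
    ext a b
    rw [Subsingleton.elim a 0, Subsingleton.elim b 0]
    simpa [Matrix.mul_apply, hV, dotProduct] using hv
  have h := hS.ucp_mem _ _ _ hX _ (isUCP_compression hVV)
  change (fun j => of fun _ _ => (((star v ⬝ᵥ (X j *ᵥ v)).re : ℝ) : ℂ) : Tuple d 1) ∈ S 1
  convert h using 1
  funext j
  ext a b
  have him : (star v ⬝ᵥ (X j *ᵥ v)).im = 0 := (hs n X hX j).im_star_dotProduct_mulVec_self v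
  have e : (compression V (X j)) a b = star v ⬝ᵥ (X j *ᵥ v) := by
    simp only [compression, LinearMap.coe_mk, AddHom.coe_mk, Matrix.mul_assoc]
    simp [Matrix.mul_apply, hV, dotProduct, mulVec]
  rw [e]
  exact Complex.ext rfl (by simpa using him.symm)

/-- Only the coordinate bounds `|x_j| ≤ 1` on the first level are used; they give `X_j² ≤ 1` for
each `j`. -/
theorem IsMatrixConvex.le_scale_matrixBall (hS : IsMatrixConvex S) (hs : IsSelfAdjointSet S)
    (h : firstLevel S ⊆ Metric.closedBall (0 : EuclideanSpace ℝ (Fin d)) 1) :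
    S ≤ scale (√(d : ℝ)) (matrixBall d) := by
  intro n X hX
  have habs : ∀ v : Fin n → ℂ, star v ⬝ᵥ v = 1 → ∀ j, |(star v ⬝ᵥ (X j *ᵥ v)).re| ≤ 1 := by
    intro v hv j
    have h1 := h (hS.numericalRange_mem hs hX hv)
    rw [mem_closedBall_zero_iff] at h1
    exact (PiLp.norm_apply_le (p := 2) _ j).trans h1
  have hsq : ∀ j, (1 - X j ^ 2).PosSemidef := fun j => by
    have hXj := hs n X hX j
    apply posSemidef_one_sub_sq
    · refine posSemidef_of_re_le (isHermitian_one.sub hXj) fun v hv => ?_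
      rw [sub_mulVec, one_mulVec, dotProduct_sub, hv, Complex.sub_re, Complex.one_re, sub_nonneg]
      exact (abs_le.1 (habs v hv j)).2
    · refine posSemidef_of_re_le (isHermitian_one.add hXj) fun v hv => ?_
      rw [add_mulVec, one_mulVec, dotProduct_add, hv, Complex.add_re, Complex.one_re]
      linarith [(abs_le.1 (habs v hv j)).1]
  rcases Nat.eq_zero_or_pos d with rfl | hd
  · exact ⟨X, ⟨fun j => j.elim0, by simpa using PosSemidef.one⟩, funext fun j => j.elim0⟩
  set r : ℝ := (√(d : ℝ))⁻¹ with hr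
  have hd' : (0 : ℝ) < d := Nat.cast_pos.2 hd
  have hrr : r ^ 2 = (d : ℝ)⁻¹ := by rw [hr, inv_pow, Real.sq_sqrt hd'.le]
  have hrd : √(d : ℝ) * r = 1 := mul_inv_cancel₀ (Real.sqrt_pos.2 hd').ne'
  refine ⟨fun j => (r : ℂ) • X j, ⟨fun j => ?_, ?_⟩, ?_⟩
  · rw [IsHermitian, conjTranspose_smul, (hs n X hX j).eq]; simp
  · have hsum : (∑ j, ((r : ℂ) ^ 2) • (1 - X j ^ 2)).PosSemidef :=
      posSemidef_sum _ fun j _ => (hsq j).smul (by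
        rw [← Complex.ofReal_pow]; exact Complex.zero_le_real.2 (sq_nonneg r))
    convert hsum using 1
    simp only [smul_pow, smul_sub, Finset.sum_sub_distrib, Finset.sum_const, Finset.card_univ,
      Fintype.card_fin]
    congr 1
    rw [← Nat.cast_smul_eq_nsmul ℂ, smul_smul, ← Complex.ofReal_pow, hrr]
    have : (d : ℂ) ≠ 0 := by exact_mod_cast hd.ne'
    push_cast
    rw [mul_inv_cancel₀ this, one_smul]
  · funext j
    rw [smul_smul, ← Complex.ofReal_mul, hrd, Complex.ofReal_one, one_smul]

theorem scale_mono (c : ℝ) {T : FreeSet d} (h : S ≤ T) : scale c S ≤ scale c T := by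
  rintro n X ⟨Y, hY, rfl⟩
  exact ⟨Y, h n hY, rfl⟩

theorem matrixBall_le_selfDualBall (d : ℕ) : matrixBall d ≤ selfDualBall d := by
  rintro n X ⟨hX, h⟩
  have hc : ∀ j, ((X j).map star).IsHermitian := fun j => isHermitian_map_star (hX j)
  have hc' : (1 - ∑ j, ((X j).map star) ^ 2).PosSemidef := by
    have e : ∀ j, ((X j).map star) ^ 2 = (X j ^ 2)ᵀ := fun j => by
      rw [map_star_eq_transpose (hX j), transpose_pow]
    have h' := h.transpose
    rw [transpose_sub, transpose_one, transpose_sum] at h'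
    rwa [Finset.sum_congr rfl fun j _ => e j]
  refine ⟨hX, (l2_opNorm_le_one_iff (isHermitian_sum_kronecker hX hc)).2 ⟨?_, ?_⟩⟩
  -- The ball is symmetric, so replacing `X` by `-X` gives the other sign.
  · have := posSemidef_one_add_sum_kronecker (fun j => (hX j).neg) hc (by simpa using h) hc'
    convert this using 1
    rw [sub_eq_add_neg, ← Finset.sum_neg_distrib]
    congr 1
    refine Finset.sum_congr rfl fun j _ => ?_
    ext; simp [kroneckerMap_apply]
  · exact posSemidef_one_add_sum_kronecker hX hc h hc'

theorem posSemidef_of_mem_selfDualBall {X : Tuple d n} (hX : X ∈ selfDualBall d n) :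
    (1 - ∑ j, X j ⊗ₖ (X j).map star).PosSemidef :=
  ((l2_opNorm_le_one_iff (isHermitian_sum_kronecker hX.1
    fun j => isHermitian_map_star (hX.1 j))).1 hX.2).1

theorem selfDualBall_le_polarDual_matrixBall (d : ℕ) :
    selfDualBall d ≤ polarDual (matrixBall d) := fun _ _ hX =>
  ⟨hX.1, fun m _ hA => posSemidef_one_sub_sum_kronecker hA.1 hX.1
    (posSemidef_of_mem_selfDualBall (matrixBall_le_selfDualBall d m hA))
    (posSemidef_of_mem_selfDualBall hX)⟩

theorem IsMatrixConvex.polarDual_matrixBall_le (hS : IsMatrixConvex S)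
    (h : Metric.closedBall (0 : EuclideanSpace ℝ (Fin d)) 1 ⊆ firstLevel S) :
    polarDual (matrixBall d) ≤ scale (√(d : ℝ)) S := by
  rintro n X ⟨hX, hXp⟩
  rcases Nat.eq_zero_or_pos d with rfl | hd
  -- For `d = 0` there are no points `± e_j`; the origin with coefficient `1` shows that level `n`
  -- of `S` is nonempty.
  · have := hS.sum_smul_mem (n := n) (x := fun _ : Unit => 0) (fun _ => h (by simp))
      (P := fun _ => 1) (fun _ => PosSemidef.one) (by simp)
    exact ⟨_, this, funext fun j => j.elim0⟩
  have : Nonempty (Fin d) := ⟨⟨0, hd⟩⟩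
  obtain ⟨P, hP, h1, hPX⟩ := exists_posSemidef_decomposition hX
    fun C hC hC' => hXp n C ⟨hC, hC'⟩
  have hmem := hS.sum_smul_mem
    (x := fun i : Fin d × Bool => EuclideanSpace.single i.1 (if i.2 then (1 : ℝ) else -1))
    (fun i => h (by
      rw [mem_closedBall_zero_iff, PiLp.norm_single]
      split_ifs <;> simp)) hP h1
  refine ⟨_, hmem, funext fun j => ?_⟩
  have e : ∑ i : Fin d × Bool, (((EuclideanSpace.single i.1
      (if i.2 then (1 : ℝ) else -1) : EuclideanSpace ℝ (Fin d)) j : ℝ) : ℂ) • P i =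
      P (j, true) - P (j, false) := by
    rw [Fintype.sum_prod_type, Finset.sum_eq_single j]
    · simp [sub_eq_add_neg]
    · intro k _ hk
      simp [hk.symm]
    · simp
  have hd' : ((√(d : ℝ) : ℝ) : ℂ) ≠ 0 :=
    Complex.ofReal_ne_zero.2 (Real.sqrt_pos.2 (Nat.cast_pos.2 hd)).ne'
  rw [e, hPX, Fintype.card_fin, smul_smul, mul_inv_cancel₀ hd', one_smul]

end MatrixConvex

/-! ### Polar duals and the extremal sets. -/

section PolarDual

open Matrix

variable {d : ℕ}

theorem one_kronecker_conj_one_sub_sum {ι : Type*} [Fintype ι] {p n k : ℕ}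
    (A : ι → Matrix (Fin p) (Fin p) ℂ)
    (X : ι → Matrix (Fin n) (Fin n) ℂ) (V : Matrix (Fin n) (Fin k) ℂ) :
    ((1 : Matrix (Fin p) (Fin p) ℂ) ⊗ₖ V)ᴴ * (1 - ∑ j, A j ⊗ₖ X j) *
      ((1 : Matrix (Fin p) (Fin p) ℂ) ⊗ₖ V) =
      (1 : Matrix (Fin p) (Fin p) ℂ) ⊗ₖ (Vᴴ * V) - ∑ j, A j ⊗ₖ (Vᴴ * X j * V) := by
  rw [conjTranspose_kronecker, conjTranspose_one, ← one_kronecker_one, Matrix.mul_sub,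
    Matrix.sub_mul, Matrix.mul_sum, Matrix.sum_mul]
  simp only [← mul_kronecker_mul, Matrix.one_mul, Matrix.mul_one]

theorem directSum_eq {m n : ℕ} (X : Tuple d m) (Y : Tuple d n) :
    ∃ (V : Matrix (Fin m) (Fin (m + n)) ℂ) (W : Matrix (Fin n) (Fin (m + n)) ℂ),
      Vᴴ * V + Wᴴ * W = 1 ∧ ∀ j, directSum X Y j = Vᴴ * X j * V + Wᴴ * Y j * W := by
  have key : ∀ (A : Matrix (Fin m) (Fin m) ℂ) (B : Matrix (Fin n) (Fin n) ℂ),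
      (fromBlocks A 0 0 B).submatrix finSumFinEquiv.symm finSumFinEquiv.symm =
      ((fromCols 1 0 : Matrix (Fin m) (Fin m ⊕ Fin n) ℂ).submatrix id finSumFinEquiv.symm)ᴴ *
        A * (fromCols 1 0 : Matrix (Fin m) (Fin m ⊕ Fin n) ℂ).submatrix id finSumFinEquiv.symm +
      ((fromCols 0 1 : Matrix (Fin n) (Fin m ⊕ Fin n) ℂ).submatrix id finSumFinEquiv.symm)ᴴ *
        B * (fromCols 0 1 : Matrix (Fin n) (Fin m ⊕ Fin n) ℂ).submatrix id finSumFinEquiv.symm := by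
    intro A B
    ext a b
    obtain ⟨a, rfl⟩ := finSumFinEquiv.surjective a
    obtain ⟨b, rfl⟩ := finSumFinEquiv.surjective b
    rcases a with a | a <;> rcases b with b | b <;>
      simp [Matrix.mul_apply, Matrix.one_apply]
  refine ⟨_, _, ?_, fun j => key (X j) (Y j)⟩
  have := key 1 1
  rw [fromBlocks_one, submatrix_one_equiv, Matrix.mul_one, Matrix.mul_one] at this
  exact this.symm

theorem one_prod_apply {m n : Type*} [DecidableEq m] [DecidableEq n] (a b : m) (i l : n) :
    (1 : Matrix (m × n) (m × n) ℂ) (a, i) (b, l) =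
      (1 : Matrix m m ℂ) a b * (1 : Matrix n n ℂ) i l := by
  rw [← one_kronecker_one]; rfl

/-- Each operation acts on the second leg of `1 - ∑ A_j ⊗ X_j` by a unital positive operation:
conjugations by `1 ⊗ V`, or an ampliation. -/
theorem isMatrixConvex_polarDual (T : FreeSet d) : IsMatrixConvex (polarDual T) where
  directSum_mem m n X Y hX hY := by
    obtain ⟨V, W, h1, hXY⟩ := directSum_eq X Y
    refine ⟨fun j => ?_, fun p A hA => ?_⟩
    · rw [hXY]
      exact (isHermitian_conjTranspose_mul_mul V (hX.1 j)).add
        (isHermitian_conjTranspose_mul_mul W (hY.1 j))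
    · have h := ((hX.2 p A hA).conjTranspose_mul_mul_same
        ((1 : Matrix (Fin p) (Fin p) ℂ) ⊗ₖ V)).add ((hY.2 p A hA).conjTranspose_mul_mul_same
        ((1 : Matrix (Fin p) (Fin p) ℂ) ⊗ₖ W))
      rw [one_kronecker_conj_one_sub_sum, one_kronecker_conj_one_sub_sum] at h
      convert h using 1
      rw [← one_kronecker_one, ← h1, kronecker_add]
      simp only [hXY, kronecker_add, Finset.sum_add_distrib]
      abel
  unitary_conj_mem n X hX U hU := by
    have hUU : Uᴴ * U = 1 := mem_unitaryGroup_iff'.1 hU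
    refine ⟨fun j => isHermitian_conjTranspose_mul_mul U (hX.1 j), fun p A hA => ?_⟩
    have h := (hX.2 p A hA).conjTranspose_mul_mul_same ((1 : Matrix (Fin p) (Fin p) ℂ) ⊗ₖ U)
    rwa [one_kronecker_conj_one_sub_sum, hUU, one_kronecker_one] at h
  ucp_mem n k X hX φ hφ := by
    refine ⟨fun j => hφ.map_isHermitian (hX.1 j), fun p A hA => ?_⟩
    convert hφ.completely_positive p _ (hX.2 p A hA) using 1
    ext ⟨a, i⟩ ⟨b, l⟩
    have e : (of fun i l => (1 - ∑ j, A j ⊗ₖ X j) (a, i) (b, l) : Matrix (Fin n) (Fin n) ℂ) =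
        (1 : Matrix (Fin p) (Fin p) ℂ) a b • (1 : Matrix (Fin n) (Fin n) ℂ) -
          ∑ j, A j a b • X j := by
      ext i l
      simp [Matrix.sum_apply, kroneckerMap_apply, one_prod_apply]
    simp only [ampliation, of_apply, e, map_sub, map_smul, map_sum, hφ.map_one]
    simp [Matrix.sum_apply, kroneckerMap_apply, one_prod_apply]

theorem isSelfAdjointSet_polarDual (T : FreeSet d) : IsSelfAdjointSet (polarDual T) :=
  fun _ _ hX => hX.1

/-- The scalar tuples `(x_1 I, …, x_d I)` with `x` in the closed Euclidean unit ball. -/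
def scalarBall (d : ℕ) : FreeSet d := fun _ =>
  {A | ∃ x : EuclideanSpace ℝ (Fin d), ‖x‖ ≤ 1 ∧ A = fun j => ((x j : ℝ) : ℂ) • 1}

/-- The largest matrix convex set whose first level is the closed unit ball. -/
def maxBall (d : ℕ) : FreeSet d := polarDual (scalarBall d)

theorem firstLevel_maxBall_subset (d : ℕ) :
    firstLevel (maxBall d) ⊆ Metric.closedBall (0 : EuclideanSpace ℝ (Fin d)) 1 := by
  intro y hy
  rw [mem_closedBall_zero_iff]
  rcases eq_or_ne y 0 with rfl | h0
  · simp
  have hy0 : 0 < ‖y‖ := norm_pos_iff.2 h0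
  -- Pairing `y` with its own direction gives `1 - ‖y‖ ≥ 0`.
  have h := (hy.2 1 _ ⟨‖y‖⁻¹ • y, by
    rw [norm_smul, norm_inv, norm_norm, inv_mul_cancel₀ hy0.ne'], rfl⟩).diag_nonneg (i := (0, 0))
  have e : (1 - ∑ j, ((((‖y‖⁻¹ • y) j : ℝ) : ℂ) • (1 : Matrix (Fin 1) (Fin 1) ℂ)) ⊗ₖ
      (of fun _ _ => ((y j : ℝ) : ℂ) : Matrix (Fin 1) (Fin 1) ℂ)) (0, 0) (0, 0) =
      ((1 - ‖y‖ : ℝ) : ℂ) := by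
    have h2 : ∑ j, (‖y‖⁻¹ * y j) * y j = ‖y‖ := by
      simp_rw [mul_assoc, ← Finset.mul_sum, ← sq]
      rw [← EuclideanSpace.real_norm_sq_eq, sq, inv_mul_cancel_left₀ hy0.ne']
    conv_rhs => rw [← h2]
    simp [Matrix.sum_apply, kroneckerMap_apply]
  rw [e] at h
  linarith [Complex.zero_le_real.1 h]

theorem closedBall_subset_firstLevel_polarDual_maxBall (d : ℕ) :
    Metric.closedBall (0 : EuclideanSpace ℝ (Fin d)) 1 ⊆ firstLevel (polarDual (maxBall d)) := by
  intro y hy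
  rw [mem_closedBall_zero_iff] at hy
  refine ⟨fun j => by ext; simp, fun m A hA => ?_⟩
  have h := (hA.2 1 _ ⟨y, hy, rfl⟩).submatrix Prod.swap
  convert h using 1
  ext ⟨a, i⟩ ⟨b, k⟩
  rw [Subsingleton.elim i 0, Subsingleton.elim k 0]
  simp [Matrix.sum_apply, kroneckerMap_apply, Matrix.one_apply, mul_comm]

/-! ### Clifford generators and optimality of the constant. -/

/-- Hermitian unitaries that anticommute. -/
structure IsClifford {n : Type*} [Fintype n] [DecidableEq n] (F : Fin d → Matrix n n ℂ) : Prop where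
  isHermitian : ∀ j, (F j).IsHermitian
  anticomm : ∀ i j, F i * F j + F j * F i = if i = j then 2 else 0

/-- Doubling: the flip of the two summands anticommutes with every `F_j ⊕ -F_j`. -/
theorem exists_isClifford_type : ∀ d : ℕ, ∃ (n : Type) (_ : Fintype n) (_ : DecidableEq n)
    (_ : Nonempty n) (F : Fin d → Matrix n n ℂ), IsClifford F
  | 0 => ⟨Unit, inferInstance, inferInstance, inferInstance, fun _ => 0,
      fun j => j.elim0, fun j => j.elim0⟩
  | d + 1 => by
    obtain ⟨n, _, _, _, F, hF⟩ := exists_isClifford_type d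
    refine ⟨n ⊕ n, inferInstance, inferInstance, inferInstance,
      Fin.cons (fromBlocks 0 1 1 0) fun j => fromBlocks (F j) 0 0 (-F j), ?_, ?_⟩
    · refine Fin.cases ?_ fun j => ?_
      · rw [Fin.cons_zero, IsHermitian, fromBlocks_conjTranspose]; simp
      · rw [Fin.cons_succ, IsHermitian, fromBlocks_conjTranspose]; simp [(hF.isHermitian j).eq]
    · have h2 : (2 : Matrix (n ⊕ n) (n ⊕ n) ℂ) = fromBlocks 2 0 0 2 := by
        rw [← one_add_one_eq_two, ← one_add_one_eq_two, ← fromBlocks_one, fromBlocks_add]; simp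
      refine Fin.cases (Fin.cases ?_ fun j => ?_) fun i => Fin.cases ?_ fun j => ?_
      · simp only [Fin.cons_zero, fromBlocks_multiply, fromBlocks_add, if_true]
        rw [h2]; simp [one_add_one_eq_two]
      · rw [if_neg (Fin.succ_ne_zero j).symm]
        simp [fromBlocks_multiply, fromBlocks_add]
      · rw [if_neg (Fin.succ_ne_zero i)]
        simp [fromBlocks_multiply, fromBlocks_add]
      · simp only [Fin.cons_succ, fromBlocks_multiply, fromBlocks_add, Fin.succ_inj]
        simp only [Matrix.mul_zero, Matrix.zero_mul, add_zero, zero_add, Matrix.neg_mul,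
          Matrix.mul_neg, neg_neg, hF.anticomm, neg_zero]
        split_ifs
        · exact h2.symm
        · exact fromBlocks_zero

theorem exists_isClifford (d : ℕ) :
    ∃ (N : ℕ) (_ : 0 < N) (F : Tuple d N), IsClifford F := by
  obtain ⟨n, _, _, _, F, hF⟩ := exists_isClifford_type d
  let e := Fintype.equivFin n
  refine ⟨Fintype.card n, Fintype.card_pos, fun j => (F j).submatrix e.symm e.symm,
    fun j => (hF.isHermitian j).submatrix _, fun i j => ?_⟩
  rw [submatrix_mul_equiv, submatrix_mul_equiv]
  change (F i * F j + F j * F i).submatrix e.symm e.symm = _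
  rw [hF.anticomm]
  split_ifs
  · rw [← one_add_one_eq_two, ← one_add_one_eq_two, submatrix_add, Pi.add_apply, Pi.add_apply,
      submatrix_one_equiv]
  · rfl

namespace IsClifford

variable {N : ℕ} {F : Tuple d N}

theorem mul_self (hF : IsClifford F) (j : Fin d) : F j * F j = 1 := by
  have h := hF.anticomm j j
  rw [if_pos rfl, ← two_smul ℂ] at h
  have h2 : (2 : Matrix (Fin N) (Fin N) ℂ) = (2 : ℂ) • 1 := by
    rw [two_smul, one_add_one_eq_two]
  rw [h2] at h
  exact smul_right_injective _ two_ne_zero h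

theorem transpose (hF : IsClifford F) : IsClifford fun j => (F j)ᵀ where
  isHermitian j := (hF.isHermitian j).transpose
  anticomm i j := by
    rw [← transpose_mul, ← transpose_mul, ← transpose_add, add_comm, hF.anticomm]
    split_ifs
    · rw [← one_add_one_eq_two, transpose_add, transpose_one]
    · exact transpose_zero

theorem sum_smul_sq (hF : IsClifford F) (x : Fin d → ℂ) :
    (∑ j, x j • F j) ^ 2 = (∑ j, x j ^ 2) • (1 : Matrix (Fin N) (Fin N) ℂ) := by
  have h1 : (∑ j, x j • F j) ^ 2 = ∑ i, ∑ j, (x i * x j) • (F i * F j) := by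
    rw [sq, Finset.sum_mul_sum]
    simp only [smul_mul_smul_comm]
  have h2 : (∑ j, x j • F j) ^ 2 = ∑ i, ∑ j, (x i * x j) • (F j * F i) := by
    rw [h1, Finset.sum_comm]
    simp only [mul_comm]
  have h3 : (2 : ℂ) • (∑ j, x j • F j) ^ 2 =
      (2 : ℂ) • ((∑ j, x j ^ 2) • (1 : Matrix (Fin N) (Fin N) ℂ)) := by
    rw [two_smul]
    nth_rewrite 1 [h1]
    rw [h2]
    simp only [← Finset.sum_add_distrib, ← smul_add, hF.anticomm, smul_ite, smul_zero,
      Finset.sum_ite_eq, Finset.mem_univ, if_true]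
    rw [smul_smul, Finset.mul_sum, Finset.sum_smul]
    refine Finset.sum_congr rfl fun i _ => ?_
    rw [← one_add_one_eq_two, ← one_add_one_eq_two, smul_add, add_mul, add_smul, one_mul, sq]
  exact smul_right_injective _ two_ne_zero h3

/-- By anticommutation `(∑ x_j F_j)² = |x|² ≤ 1`, hence `∑ x_j F_j ≤ 1`. -/
theorem mem_maxBall (hF : IsClifford F) : F ∈ maxBall d N := by
  refine ⟨hF.isHermitian, ?_⟩
  rintro m _ ⟨x, hx, rfl⟩
  have hT : (∑ j, ((x j : ℝ) : ℂ) • F j).IsHermitian := isHermitian_sum fun j => by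
    rw [IsHermitian, conjTranspose_smul, (hF.isHermitian j).eq]; simp
  have h : (1 - ∑ j, ((x j : ℝ) : ℂ) • F j).PosSemidef := by
    refine posSemidef_one_sub_of_sq hT ?_
    have e : (1 : Matrix (Fin N) (Fin N) ℂ) - (∑ j, ((x j : ℝ) : ℂ) • F j) ^ 2 =
        ((1 - ‖x‖ ^ 2 : ℝ) : ℂ) • (1 : Matrix (Fin N) (Fin N) ℂ) := by
      rw [hF.sum_smul_sq, EuclideanSpace.real_norm_sq_eq]
      push_cast
      rw [sub_smul, one_smul]
    rw [e]
    refine PosSemidef.one.smul (Complex.zero_le_real.2 ?_)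
    nlinarith [norm_nonneg x]
  convert posSemidef_kronecker (PosSemidef.one (n := Fin m) (R := ℂ)) h using 1
  rw [kronecker_sub, kronecker_sum, one_kronecker_one]
  congr 1
  refine Finset.sum_congr rfl fun j _ => ?_
  rw [smul_kronecker, kronecker_smul]

/-- `F / √d` lies in the matrix ball. -/
theorem smul_mem_matrixBall (hF : IsClifford F) (hd : 0 < d) :
    (fun j => (((√(d : ℝ))⁻¹ : ℝ) : ℂ) • F j) ∈ matrixBall d N := by
  refine ⟨fun j => ?_, ?_⟩
  · rw [IsHermitian, conjTranspose_smul, (hF.isHermitian j).eq]; simp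
  · have hd' : (d : ℝ) ≠ 0 := Nat.cast_ne_zero.2 hd.ne'
    have e : ∑ j : Fin d, ((((√(d : ℝ))⁻¹ : ℝ) : ℂ) • F j) ^ 2 = 1 := by
      simp only [smul_pow, sq (F _), hF.mul_self, Finset.sum_const, Finset.card_univ,
        Fintype.card_fin]
      rw [← Nat.cast_smul_eq_nsmul ℂ, smul_smul, ← Complex.ofReal_pow, inv_pow,
        Real.sq_sqrt (Nat.cast_nonneg d), ← Complex.ofReal_natCast, ← Complex.ofReal_mul,
        mul_inv_cancel₀ hd', Complex.ofReal_one, one_smul]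
    rw [e, sub_self]
    exact .zero

/-- If `F = C Y`, evaluating at the vectorised identity gives `∑ tr Y_j² ≤ N`. Multiplying by `C²`,
which allows `C = 0`, gives `d N ≤ C² N`. -/
theorem sqrt_le_of_mem_scale_selfDualBall (hF : IsClifford F) (hN : 0 < N) {C : ℝ} (hC : 0 ≤ C)
    (h : F ∈ scale C (selfDualBall d) N) : √(d : ℝ) ≤ C := by
  obtain ⟨Y, hY, rfl⟩ := h
  have h := (posSemidef_of_mem_selfDualBall hY).dotProduct_mulVec_nonneg
    (1 : Matrix (Fin N) (Fin N) ℂ).vec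
  rw [star_vec_one_sub_sum_mulVec_vec] at h
  simp only [conjTranspose_one, Matrix.one_mul, Matrix.mul_one, trace_one, Fintype.card_fin,
    fun j => map_star_eq_transpose (hY.1 j), ← transpose_mul, trace_transpose] at h
  have hYY : ∀ j, ((C ^ 2 : ℝ) : ℂ) * (Y j * Y j).trace = N := fun j => by
    have := congrArg trace (hF.mul_self j)
    rw [smul_mul_smul_comm, trace_smul, trace_one, Fintype.card_fin, smul_eq_mul] at this
    rw [← this]; push_cast; ring
  have h2 := mul_nonneg (Complex.zero_le_real.2 (sq_nonneg C)) h
  rw [mul_sub, Finset.mul_sum, Finset.sum_congr rfl fun j _ => hYY j, Finset.sum_const,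
    Finset.card_univ, Fintype.card_fin, nsmul_eq_mul] at h2
  have h3 : 0 ≤ C ^ 2 * N - d * N := by exact_mod_cast h2
  have hN' : (0 : ℝ) < N := Nat.cast_pos.2 hN
  exact Real.sqrt_le_iff.2 ⟨hC, by nlinarith⟩

/-- Pairing with `Fᵀ ∈ maxBall` at the vectorised identity gives `∑ tr (Y_j F_j) ≤ N`. Multiplying
by `C` gives `d N / √d ≤ C N`. -/
theorem sqrt_le_of_mem_scale_polarDual_maxBall (hF : IsClifford F) (hN : 0 < N)
    {C : ℝ} (hC : 0 ≤ C)
    (h : (fun j => (((√(d : ℝ))⁻¹ : ℝ) : ℂ) • F j) ∈ scale C (polarDual (maxBall d)) N) :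
    √(d : ℝ) ≤ C := by
  obtain ⟨Y, hY, hFY⟩ := h
  have h := (hY.2 N _ hF.transpose.mem_maxBall).dotProduct_mulVec_nonneg
    (1 : Matrix (Fin N) (Fin N) ℂ).vec
  rw [star_vec_one_sub_sum_mulVec_vec] at h
  simp only [conjTranspose_one, Matrix.one_mul, Matrix.mul_one, trace_one, Fintype.card_fin,
    transpose_transpose] at h
  have hYF : ∀ j, (C : ℂ) * (Y j * F j).trace = (((√(d : ℝ))⁻¹ * N : ℝ) : ℂ) := fun j => by
    have : (((√(d : ℝ))⁻¹ : ℝ) : ℂ) • F j = (C : ℂ) • Y j := congrFun hFY j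
    rw [← smul_eq_mul, ← trace_smul, ← smul_mul_assoc, ← this, smul_mul_assoc, hF.mul_self,
      trace_smul, trace_one, Fintype.card_fin, smul_eq_mul]
    push_cast; rfl
  have h2 := mul_nonneg (Complex.zero_le_real.2 hC) h
  rw [mul_sub, Finset.mul_sum, Finset.sum_congr rfl fun j _ => hYF j, Finset.sum_const,
    Finset.card_univ, Fintype.card_fin, nsmul_eq_mul] at h2
  have h3 : 0 ≤ C * N - d * ((√(d : ℝ))⁻¹ * N) := by exact_mod_cast h2
  have hN' : (0 : ℝ) < N := Nat.cast_pos.2 hN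
  have h4 : (d : ℝ) * ((√(d : ℝ))⁻¹ * N) = √(d : ℝ) * N := by
    rw [← mul_assoc, ← div_eq_mul_inv, Real.div_sqrt]
  rw [h4] at h3
  nlinarith

end IsClifford

end PolarDual

end MatrixBall

theorem theorem8p4 (d : ℕ) :
    -- first implication
    (∀ S : MatrixBall.FreeSet d, MatrixBall.IsSelfAdjointSet S → MatrixBall.IsMatrixConvex S →
      MatrixBall.firstLevel S ⊆ Metric.closedBall (0 : EuclideanSpace ℝ (Fin d)) 1 →
        S ≤ MatrixBall.scale (√(d : ℝ)) (MatrixBall.matrixBall d) ∧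
        MatrixBall.scale (√(d : ℝ)) (MatrixBall.matrixBall d) ≤
          MatrixBall.scale (√(d : ℝ)) (MatrixBall.selfDualBall d)) ∧
    -- second implication
    (∀ S : MatrixBall.FreeSet d, MatrixBall.IsSelfAdjointSet S → MatrixBall.IsMatrixConvex S →
      Metric.closedBall (0 : EuclideanSpace ℝ (Fin d)) 1 ⊆ MatrixBall.firstLevel S →
        MatrixBall.selfDualBall d ≤ MatrixBall.polarDual (MatrixBall.matrixBall d) ∧
        MatrixBall.polarDual (MatrixBall.matrixBall d) ≤ MatrixBall.scale (√(d : ℝ)) S) ∧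
    -- the constant is optimal in the first implication, for both balls
    (∀ C : ℝ, 0 ≤ C →
      (∀ S : MatrixBall.FreeSet d, MatrixBall.IsSelfAdjointSet S → MatrixBall.IsMatrixConvex S →
        MatrixBall.firstLevel S ⊆ Metric.closedBall (0 : EuclideanSpace ℝ (Fin d)) 1 →
          S ≤ MatrixBall.scale C (MatrixBall.matrixBall d)) → √(d : ℝ) ≤ C) ∧
    (∀ C : ℝ, 0 ≤ C →
      (∀ S : MatrixBall.FreeSet d, MatrixBall.IsSelfAdjointSet S → MatrixBall.IsMatrixConvex S →
        MatrixBall.firstLevel S ⊆ Metric.closedBall (0 : EuclideanSpace ℝ (Fin d)) 1 →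
          S ≤ MatrixBall.scale C (MatrixBall.selfDualBall d)) → √(d : ℝ) ≤ C) ∧
    -- the constant is optimal in the second implication, for both balls
    (∀ C : ℝ, 0 ≤ C →
      (∀ S : MatrixBall.FreeSet d, MatrixBall.IsSelfAdjointSet S → MatrixBall.IsMatrixConvex S →
        Metric.closedBall (0 : EuclideanSpace ℝ (Fin d)) 1 ⊆ MatrixBall.firstLevel S →
          MatrixBall.polarDual (MatrixBall.matrixBall d) ≤ MatrixBall.scale C S) → √(d : ℝ) ≤ C) ∧
    (∀ C : ℝ, 0 ≤ C →
      (∀ S : MatrixBall.FreeSet d, MatrixBall.IsSelfAdjointSet S → MatrixBall.IsMatrixConvex S →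
        Metric.closedBall (0 : EuclideanSpace ℝ (Fin d)) 1 ⊆ MatrixBall.firstLevel S →
          MatrixBall.selfDualBall d ≤ MatrixBall.scale C S) → √(d : ℝ) ≤ C) := by
  obtain ⟨N, hN, F, hF⟩ := MatrixBall.exists_isClifford d
  -- Since `𝔅 ⊆ 𝔇 ⊆ 𝔅•`, the four optimality claims reduce to the two involving `𝔇`, each tested on
  -- one set.
  have opt₁ : ∀ C : ℝ, 0 ≤ C →
      MatrixBall.maxBall d ≤ MatrixBall.scale C (MatrixBall.selfDualBall d) → √(d : ℝ) ≤ C :=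
    fun C hC h => hF.sqrt_le_of_mem_scale_selfDualBall hN hC (h N hF.mem_maxBall)
  have opt₂ : ∀ C : ℝ, 0 ≤ C → MatrixBall.selfDualBall d ≤
      MatrixBall.scale C (MatrixBall.polarDual (MatrixBall.maxBall d)) → √(d : ℝ) ≤ C := by
    intro C hC h
    rcases Nat.eq_zero_or_pos d with rfl | hd
    · simpa using hC
    · exact hF.sqrt_le_of_mem_scale_polarDual_maxBall hN hC
        (h N (MatrixBall.matrixBall_le_selfDualBall d N (hF.smul_mem_matrixBall hd)))
  refine ⟨fun S hs hS h => ⟨hS.le_scale_matrixBall hs h,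
      MatrixBall.scale_mono _ (MatrixBall.matrixBall_le_selfDualBall d)⟩,
    fun S _ hS h => ⟨MatrixBall.selfDualBall_le_polarDual_matrixBall d,
      hS.polarDual_matrixBall_le h⟩,
    fun C hC h => opt₁ C hC ?_, fun C hC h => opt₁ C hC ?_,
    fun C hC h => opt₂ C hC ?_, fun C hC h => opt₂ C hC ?_⟩
  · exact (h _ (MatrixBall.isSelfAdjointSet_polarDual _) (MatrixBall.isMatrixConvex_polarDual _)
      (MatrixBall.firstLevel_maxBall_subset d)).trans
      (MatrixBall.scale_mono C (MatrixBall.matrixBall_le_selfDualBall d))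
  · exact h _ (MatrixBall.isSelfAdjointSet_polarDual _) (MatrixBall.isMatrixConvex_polarDual _)
      (MatrixBall.firstLevel_maxBall_subset d)
  · exact (MatrixBall.selfDualBall_le_polarDual_matrixBall d).trans
      (h _ (MatrixBall.isSelfAdjointSet_polarDual _) (MatrixBall.isMatrixConvex_polarDual _)
        (MatrixBall.closedBall_subset_firstLevel_polarDual_maxBall d))
  · exact h _ (MatrixBall.isSelfAdjointSet_polarDual _) (MatrixBall.isMatrixConvex_polarDual _)
      (MatrixBall.closedBall_subset_firstLevel_polarDual_maxBall d)
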